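/- Let $B$ be a complete boolean algebra. Let $\mathcal{NO}(B)$ be the set of necessity operators on $B$, that is, of functions $f\colon B\to B$ that preserve finite meets (so $f(1)=1$ and $f(a\wedge b)=f(a)\wedge f(b)$ for all $a,b\in B$), partially ordered by $f\le g$ iff $f(a)\le g(a)$ for all $a\in B$. Then $\mathcal{NO}(B)$ is a frame (a complete lattice satisfying $a\wedge\bigvee S=\bigvee\{a\wedge b\mid b\in S\}$ for every element $a$ and every subset $S$), and this frame is zero-dimensional, i.e., each of its elements is a join of complemented elements. Moreover, the frame $\mathcal{NO}(B)$ is spatial (isomorphic to the frame of open sets of some topological space) if and only if $B$ is atomic, i.e., every nonzero element of $B$ has an atom below it. -/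

import Mathlib

universe u

/-- A necessity operator on a boolean algebra `B` is a unary function on `B` that preserves
finite meets, i.e. it preserves binary meets and the empty meet `⊤`. The poset of
necessity operators is the type of these functions with the pointwise order, which is
Mathlib's order on `InfTopHom`. -/
abbrev NecessityOperator (B : Type u) [BooleanAlgebra B] : Type u := InfTopHom B B

/-- The order on necessity operators is pointwise. -/
theorem NecessityOperator.le_iff {B : Type u} [BooleanAlgebra B] (f g : NecessityOperator B) :
    f ≤ g ↔ ∀ a : B, f a ≤ g a := Iff.rfl

/-- The poset `L` is a frame: its order is the order of a complete lattice in which binary meets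
distribute over arbitrary joins. (The frame structure is unique if it exists.) -/
def IsFrame (L : Type u) [P : PartialOrder L] : Prop :=
  ∃ F : Order.Frame L, F.toPartialOrder = P

/-- A frame is zero-dimensional if its complemented elements join-generate it: every element is
the join of a set of complemented elements. -/
def Order.Frame.IsZeroDimensional (L : Type u) [Order.Frame L] : Prop :=
  ∀ a : L, ∃ S : Set L, (∀ c ∈ S, IsComplemented c) ∧ a = sSup S

/-- The poset `L` is a zero-dimensional frame. -/
def IsZeroDimensionalFrame (L : Type u) [P : PartialOrder L] : Prop :=
  ∃ F : Order.Frame L, F.toPartialOrder = P ∧ Order.Frame.IsZeroDimensional L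

/-- The poset `L` is a spatial frame: it is a frame, and it is isomorphic to the frame of open
sets of a topological space. (Isomorphisms of frames are the same as order isomorphisms.) -/
def IsSpatialFrame (L : Type u) [PartialOrder L] : Prop :=
  IsFrame L ∧ ∃ (X : Type u) (_ : TopologicalSpace X),
    Nonempty (L ≃o TopologicalSpace.Opens X)

/-! Meets are pointwise and Heyting implication has an explicit formula, so the operators form a
frame. Each `f` is the join of the operators `step a (f a)`, and every `step` is a meet of two
complemented elements. If `B` is atomic, an atom `x` and a prime filter `F` give a meet-prime
`threshold F xᶜ`; the prime ideal theorem makes these separate operators. Conversely, `const` is a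
frame homomorphism from `B`, so points of the operator frame pull back to points of `B`, and a point
of a complete boolean algebra is given by an atom. -/

namespace NecessityOperator

variable {B : Type u}

/-! ### The frame structure -/

section CompleteBooleanAlgebra

variable [CompleteBooleanAlgebra B]

/-- Pointwise infima of necessity operators. -/
instance : InfSet (NecessityOperator B) where
  sInf S :=
    { toFun := fun a => ⨅ f ∈ S, f a
      map_inf' := fun _ _ => by simp only [map_inf, iInf_inf_eq]
      map_top' := by simp only [map_top, iInf_top] }

theorem isGLB_sInf (S : Set (NecessityOperator B)) : IsGLB S (sInf S) :=
  ⟨fun f hf _ => iInf₂_le f hf, fun _ hg a => le_iInf₂ fun _ hf => hg hf a⟩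

instance : CompleteLattice (NecessityOperator B) where
  __ := completeLatticeOfInf (NecessityOperator B) isGLB_sInf
  -- Keeps binary meets definitionally pointwise.
  inf := (· ⊓ ·)
  inf_le_left _ _ := inf_le_left
  inf_le_right _ _ := inf_le_right
  le_inf _ _ _ := le_inf
  top := ⊤
  le_top _ := le_top

theorem inf_apply (f g : NecessityOperator B) (a : B) : (f ⊓ g) a = f a ⊓ g a := rfl

/-- The relative pseudocomplement: the value at `a` is the meet of the implications
`f d ⇨ g d` over all `d ≥ a`. -/
instance : HImp (NecessityOperator B) where
  himp f g :=
    { toFun := fun a => ⨅ d, ⨅ _ : a ≤ d, f d ⇨ g d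
      map_inf' := fun a b => by
        refine le_antisymm (le_inf ?_ ?_) (le_iInf₂ fun d hd => le_himp_iff.2 ?_)
        · exact le_iInf₂ fun d hd => iInf₂_le d (inf_le_left.trans hd)
        · exact le_iInf₂ fun d hd => iInf₂_le d (inf_le_right.trans hd)
        -- Use the index `d ⊔ c`, which lies above both `c` and `d`; distributivity then recovers
        -- `d` from `d ⊔ a` and `d ⊔ b`.
        · have key : ∀ c, (⨅ e, ⨅ _ : c ≤ e, f e ⇨ g e) ⊓ f d ≤ g (d ⊔ c) := fun c =>
            (inf_le_inf (iInf₂_le (d ⊔ c) le_sup_right)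
              (OrderHomClass.mono f le_sup_left)).trans himp_inf_le
          calc _ ≤ g (d ⊔ a) ⊓ g (d ⊔ b) :=
                le_inf ((inf_le_inf_right _ inf_le_left).trans (key a))
                  ((inf_le_inf_right _ inf_le_right).trans (key b))
            _ = g d := by rw [← map_inf, ← sup_inf_left, sup_eq_left.2 hd]
      map_top' := by simp }

instance : Order.Frame (NecessityOperator B) where
  le_himp_iff f g h := by
    constructor
    · intro H a
      exact le_himp_iff.1 ((H a).trans (iInf₂_le a le_rfl))
    · intro H a
      exact le_iInf₂ fun d hd =>
        (OrderHomClass.mono f hd).trans (le_himp_iff.2 (H d))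
  compl f := f ⇨ ⊥
  himp_bot _ := rfl

end CompleteBooleanAlgebra

/-! ### Operators attached to filters -/

section Threshold

variable [BooleanAlgebra B]

open Classical in
/-- The necessity operator with value `⊤` on the filter `F` and value `v` elsewhere. -/
noncomputable def threshold (F : Order.PFilter B) (v : B) : NecessityOperator B where
  toFun c := if c ∈ F then ⊤ else v
  map_inf' a b := by
    by_cases ha : a ∈ F <;> by_cases hb : b ∈ F <;> simp [Order.PFilter.inf_mem_iff, ha, hb]
  map_top' := if_pos Order.PFilter.top_mem

theorem threshold_of_mem {F : Order.PFilter B} {c : B} (hc : c ∈ F) (v : B) :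
    threshold F v c = ⊤ := if_pos hc

theorem threshold_of_notMem {F : Order.PFilter B} {c : B} (hc : c ∉ F) (v : B) :
    threshold F v c = v := if_neg hc

theorem le_threshold_apply (F : Order.PFilter B) (v c : B) : v ≤ threshold F v c := by
  by_cases hc : c ∈ F
  · simp [threshold_of_mem hc]
  · simp [threshold_of_notMem hc]

theorem le_threshold_iff {F : Order.PFilter B} {v : B} {f : NecessityOperator B} :
    f ≤ threshold F v ↔ ∀ c ∉ F, f c ≤ v := by
  constructor
  · intro h c hc
    exact (h c).trans_eq (threshold_of_notMem hc v)
  · intro h c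
    by_cases hc : c ∈ F
    · simp [threshold_of_mem hc]
    · simpa [threshold_of_notMem hc] using h c hc

/-- The necessity operator that is constantly `b` below `⊤`. -/
noncomputable def const (b : B) : NecessityOperator B := threshold (Order.PFilter.principal ⊤) b

theorem const_apply {b c : B} (hc : c ≠ ⊤) : const b c = b :=
  threshold_of_notMem (by simpa using hc) b

theorem le_const_iff {b : B} {f : NecessityOperator B} : f ≤ const b ↔ ∀ c, c ≠ ⊤ → f c ≤ b := by
  simp [const, le_threshold_iff]

theorem const_le_iff {b : B} {f : NecessityOperator B} : const b ≤ f ↔ b ≤ f ⊥ := by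
  constructor
  · exact fun h => (le_threshold_apply _ b ⊥).trans (h ⊥)
  · intro h c
    by_cases hc : c = ⊤
    · simp [hc]
    · rw [const_apply hc]
      exact h.trans (OrderHomClass.mono f bot_le)

end Threshold

/-! ### Complemented elements -/

section ZeroDimensional

variable [CompleteBooleanAlgebra B]

theorem eq_top_iff_apply_bot {f : NecessityOperator B} : f = ⊤ ↔ f ⊥ = ⊤ := by
  constructor
  · rintro rfl
    rfl
  · intro h
    refine top_unique fun c => ?_
    rw [top_unique (h.symm.trans_le (OrderHomClass.mono f (bot_le (a := c))))]
    exact le_top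

theorem bot_eq_const : (⊥ : NecessityOperator B) = const (⊥ : B) :=
  (bot_unique (a := (const ⊥ : NecessityOperator B)) (const_le_iff.2 bot_le)).symm

theorem eq_bot_of_forall {f : NecessityOperator B} (h : ∀ c, c ≠ ⊤ → f c = ⊥) : f = ⊥ :=
  bot_unique ((le_const_iff.2 fun c hc => (h c hc).le).trans_eq bot_eq_const.symm)

theorem const_inf (b c : B) : (const (b ⊓ c) : NecessityOperator B) = const b ⊓ const c := by
  apply DFunLike.ext
  intro d
  by_cases hd : d = ⊤
  · rw [hd, map_top, map_top]
  · rw [inf_apply, const_apply hd, const_apply hd, const_apply hd]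

/-- By `const_le_iff`, `const` is left adjoint to evaluation at `⊥`. -/
theorem const_sSup (S : Set B) : (const (sSup S) : NecessityOperator B) = ⨆ b ∈ S, const b :=
  le_antisymm
    (const_le_iff.2 <| sSup_le fun b hb =>
      const_le_iff.1 (le_iSup₂ (f := fun b (_ : b ∈ S) => const b) b hb))
    (iSup₂_le fun _ hb => const_le_iff.2 ((le_sSup hb).trans (const_le_iff.1 le_rfl)))

theorem const_top : (const ⊤ : NecessityOperator B) = ⊤ :=
  top_unique fun c => le_top.trans (le_threshold_apply _ ⊤ c)

theorem const_sup (b c : B) : (const (b ⊔ c) : NecessityOperator B) = const b ⊔ const c := by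
  rw [← sSup_pair, const_sSup, iSup_pair]

theorem isCompl_const (b : B) : IsCompl (const b : NecessityOperator B) (const bᶜ) :=
  IsCompl.of_eq (by rw [← const_inf, inf_compl_eq_bot, bot_eq_const])
    (by rw [← const_sup, sup_compl_eq_top, const_top])

theorem isCompl_threshold_principal (a : B) :
    IsCompl (threshold (Order.PFilter.principal a) ⊥ : NecessityOperator B)
      (threshold (Order.PFilter.principal aᶜ) ⊥) := by
  refine IsCompl.of_eq (eq_bot_of_forall fun c hc => ?_) (eq_top_iff_apply_bot.2 ?_)
  · rw [inf_apply]
    by_cases hac : a ≤ c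
    · have hac' : ¬ aᶜ ≤ c := fun h =>
        hc (top_unique (sup_compl_eq_top.symm.trans_le (sup_le hac h)))
      rw [threshold_of_notMem (F := Order.PFilter.principal aᶜ) hac', inf_bot_eq]
    · rw [threshold_of_notMem (F := Order.PFilter.principal a) hac, bot_inf_eq]
  · set s := (threshold (Order.PFilter.principal a) ⊥ : NecessityOperator B) ⊔
      threshold (Order.PFilter.principal aᶜ) ⊥ with hs
    have h1 : s a = ⊤ := top_unique <|
      (threshold_of_mem (F := Order.PFilter.principal a) (le_refl a) ⊥).symm.trans_le
        ((le_sup_left : _ ≤ s) a)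
    have h2 : s aᶜ = ⊤ := top_unique <|
      (threshold_of_mem (F := Order.PFilter.principal aᶜ) (le_refl aᶜ) ⊥).symm.trans_le
        ((le_sup_right : _ ≤ s) aᶜ)
    -- Joins are not pointwise, but `s` preserves the meet `a ⊓ aᶜ = ⊥`.
    rw [← inf_compl_eq_bot (a := a), map_inf, h1, h2, inf_top_eq]

/-- The least necessity operator with value at least `b` at `a`. -/
noncomputable def step (a b : B) : NecessityOperator B :=
  const b ⊓ threshold (Order.PFilter.principal a) ⊥

theorem isComplemented_step (a b : B) : IsComplemented (step a b) :=
  IsComplemented.inf ⟨_, isCompl_const b⟩ ⟨_, isCompl_threshold_principal a⟩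

theorem step_le_iff {a b : B} {f : NecessityOperator B} : step a b ≤ f ↔ b ≤ f a := by
  constructor
  · intro h
    refine le_trans (le_inf (le_threshold_apply _ b a) ?_) (h a)
    exact le_top.trans_eq (threshold_of_mem (F := Order.PFilter.principal a) (le_refl a) ⊥).symm
  · intro h c
    rw [step, inf_apply]
    by_cases hac : a ≤ c
    · by_cases hc : c = ⊤
      · simp [hc]
      · rw [const_apply hc]
        exact inf_le_left.trans (h.trans (OrderHomClass.mono f hac))
    · rw [threshold_of_notMem (F := Order.PFilter.principal a) hac, inf_bot_eq]
      exact bot_le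

theorem isZeroDimensional : Order.Frame.IsZeroDimensional (NecessityOperator B) := fun f =>
  ⟨Set.range fun a => step a (f a), Set.forall_mem_range.2 fun a => isComplemented_step a (f a),
    le_antisymm (fun a => step_le_iff.1 (le_sSup (Set.mem_range_self (f := fun a => step a (f a)) a)))
      (sSup_le (Set.forall_mem_range.2 fun _ => step_le_iff.2 le_rfl))⟩

end ZeroDimensional

end NecessityOperator

/-! ### Meet-prime elements and spatiality -/

section Primes

variable (L : Type u) [CompleteLattice L]

/-- The spectrum of meet-prime elements of a complete lattice. -/
def PrimeSpec : Type u := {q : L // InfPrime q}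

variable {L}

/-- The set of meet-prime elements that do not lie above `a`. -/
def PrimeSpec.basicOpen (a : L) : Set (PrimeSpec L) := {q | ¬ a ≤ q.1}

theorem PrimeSpec.basicOpen_inf (a b : L) : basicOpen (a ⊓ b) = basicOpen a ∩ basicOpen b := by
  ext q
  exact (not_congr q.2.inf_le).trans not_or

theorem PrimeSpec.basicOpen_sSup (S : Set L) : basicOpen (sSup S) = ⋃ a ∈ S, basicOpen a := by
  ext q
  simp [basicOpen]

/-- The hull-kernel topology: the open sets are exactly the basic ones. -/
instance : TopologicalSpace (PrimeSpec L) where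
  IsOpen U := ∃ a, PrimeSpec.basicOpen a = U
  isOpen_univ := ⟨⊤, Set.eq_univ_of_forall fun q h => q.2.1 (isMax_iff_eq_top.2 (top_unique h))⟩
  isOpen_inter := by
    rintro _ _ ⟨a, rfl⟩ ⟨b, rfl⟩
    exact ⟨a ⊓ b, PrimeSpec.basicOpen_inf a b⟩
  isOpen_sUnion := by
    intro 𝒰 h𝒰
    refine ⟨sSup {a | PrimeSpec.basicOpen a ∈ 𝒰}, ?_⟩
    rw [PrimeSpec.basicOpen_sSup]
    ext q
    simp only [Set.mem_iUnion, Set.mem_sUnion]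
    constructor
    · rintro ⟨a, ha, hq⟩
      exact ⟨_, ha, hq⟩
    · rintro ⟨U, hU, hq⟩
      obtain ⟨a, rfl⟩ := h𝒰 U hU
      exact ⟨a, hU, hq⟩

/-- A complete lattice with enough meet-prime elements is isomorphic to the lattice of open sets
of its spectrum. -/
noncomputable def PrimeSpec.orderIsoOpens
    (h : ∀ a b : L, ¬ a ≤ b → ∃ q, InfPrime q ∧ b ≤ q ∧ ¬ a ≤ q) :
    L ≃o TopologicalSpace.Opens (PrimeSpec L) :=
  RelIso.ofSurjective
    (OrderEmbedding.ofMapLEIff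
      (fun a => (⟨basicOpen a, a, rfl⟩ : TopologicalSpace.Opens (PrimeSpec L)))
      fun a b => by
        constructor
        · intro hab
          by_contra hn
          obtain ⟨q, hq, hbq, haq⟩ := h a b hn
          exact (show (⟨q, hq⟩ : PrimeSpec L) ∈ basicOpen b from hab haq) hbq
        · exact fun hab q hq hbq => hq (hab.trans hbq))
    fun ⟨_, a, ha⟩ => ⟨a, TopologicalSpace.Opens.ext ha⟩

end Primes

/-! ### Atomic algebras -/

namespace NecessityOperator

variable {B : Type u} [CompleteBooleanAlgebra B]

theorem _root_.IsAtom.le_compl_iff {x b : B} (hx : IsAtom x) : b ≤ xᶜ ↔ ¬ x ≤ b := by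
  rw [le_compl_iff_disjoint_left, hx.not_le_iff_disjoint]

/-- As `x` is an atom, an operator is not below the threshold iff its value lies above `x` somewhere
off the filter. The complement of a prime filter is an ideal, so two such places have their join off
the filter too. -/
theorem infPrime_threshold {x : B} (hx : IsAtom x) (P : Order.Ideal.PrimePair B) :
    InfPrime (threshold P.F xᶜ) := by
  have hbot : (⊥ : B) ∉ P.F := fun h => Set.disjoint_left.1 P.disjoint P.I.bot_mem h
  have notMem_iff : ∀ {c}, c ∉ P.F ↔ c ∈ P.I := fun {c} =>
    (Set.ext_iff.1 P.compl_F_eq_I c)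
  refine ⟨fun h => ?_, fun {f g} hfg => ?_⟩
  · have := eq_top_iff_apply_bot.1 (isMax_iff_eq_top.1 h)
    rw [threshold_of_notMem hbot, compl_eq_top] at this
    exact hx.1 this
  · by_contra! hn
    simp only [le_threshold_iff, not_forall, hx.le_compl_iff, not_not] at hn
    obtain ⟨⟨c, hc, hxc⟩, d, hd, hxd⟩ := hn
    have hcd : c ⊔ d ∉ P.F :=
      notMem_iff.2 (Order.Ideal.sup_mem (notMem_iff.1 hc) (notMem_iff.1 hd))
    have hle : x ≤ xᶜ := le_trans (le_inf (hxc.trans (OrderHomClass.mono f le_sup_left))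
      (hxd.trans (OrderHomClass.mono g le_sup_right))) (le_threshold_iff.1 hfg _ hcd)
    exact hx.1 (le_compl_self.1 hle)

/-- The filter of all elements whose image under `g` lies above `x`. -/
def filterAbove (g : NecessityOperator B) (x : B) : Order.PFilter B :=
  (Order.IsPFilter.of_def (F := {c | x ≤ g c}) ⟨⊤, by simp⟩
    (fun c hc d hd => ⟨c ⊓ d, by simpa using ⟨hc, hd⟩, inf_le_left, inf_le_right⟩)
    (fun hcd hc => hc.trans (OrderHomClass.mono g hcd))).toPFilter

theorem mem_filterAbove {g : NecessityOperator B} {x c : B} :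
    c ∈ filterAbove g x ↔ x ≤ g c := Iff.rfl

theorem exists_infPrime_of_not_le [IsAtomic B] {f g : NecessityOperator B} (hfg : ¬ f ≤ g) :
    ∃ q, InfPrime q ∧ g ≤ q ∧ ¬ f ≤ q := by
  obtain ⟨a, ha⟩ := not_forall.1 (mt (le_iff f g).2 hfg)
  obtain ⟨x, hx, hxa⟩ := (IsAtomic.eq_bot_or_exists_atom_le (f a \ g a)).resolve_left
    (mt sdiff_eq_bot_iff.1 ha)
  have hxf : x ≤ f a := hxa.trans sdiff_le
  have hxg : ¬ x ≤ g a := fun h =>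
    hx.1 (disjoint_self.1 ((disjoint_sdiff_self_left (y := f a)).mono hxa h))
  have hdisj : Disjoint (filterAbove g x : Set B) (Order.Ideal.principal a : Set B) :=
    Set.disjoint_left.2 fun c hc hca => hxg (le_trans hc (OrderHomClass.mono g hca))
  -- The complement of `J` is a prime filter that contains `filterAbove g x` but omits `a`.
  obtain ⟨J, hJ, haJ, hdJ⟩ := DistribLattice.prime_ideal_of_disjoint_filter_ideal hdisj
  let P := hJ.toPrimePair
  have notMem_iff : ∀ {c}, c ∉ P.F ↔ c ∈ J := fun {c} => Set.ext_iff.1 P.compl_F_eq_I c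
  refine ⟨_, infPrime_threshold hx P, le_threshold_iff.2 fun c hc => ?_, fun h => ?_⟩
  · rw [hx.le_compl_iff]
    exact fun hxc => Set.disjoint_left.1 hdJ (mem_filterAbove.2 hxc) (notMem_iff.1 hc)
  · have := hxf.trans (le_threshold_iff.1 h a (notMem_iff.2 (haJ (le_refl a))))
    exact hx.1 (le_compl_self.1 this)

theorem isFrame : IsFrame (NecessityOperator B) := ⟨inferInstance, rfl⟩

theorem isSpatialFrame [IsAtomic B] : IsSpatialFrame (NecessityOperator B) :=
  ⟨isFrame, PrimeSpec (NecessityOperator B), inferInstance,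
    ⟨PrimeSpec.orderIsoOpens fun _ _ => exists_infPrime_of_not_le⟩⟩

end NecessityOperator

/-! ### From points to atoms -/

/-- An element lying in some completely prime filter of a complete boolean algebra has an atom
below it. -/
theorem exists_isAtom_le_of_frameHom {B : Type u} [CompleteBooleanAlgebra B] (p : FrameHom B Prop)
    {b : B} (hb : p b) : ∃ a, IsAtom a ∧ a ≤ b := by
  -- The largest element outside the filter; its complement is the atom.
  set s : B := sSup {c | ¬ p c} with hs
  have hps : ¬ p s := by
    rw [hs, map_sSup]
    rintro ⟨_, ⟨c, hc, rfl⟩, hpc⟩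
    exact hc hpc
  have mem_or : ∀ c, p c ∨ p cᶜ := fun c => by
    have h : p (c ⊔ cᶜ) = (p c ⊔ p cᶜ) := map_sup p c cᶜ
    rw [sup_compl_eq_top, map_top] at h
    exact h.mp trivial
  have not_both : ∀ c, p c → ¬ p cᶜ := fun c h h' => by
    have h2 : p (c ⊓ cᶜ) = (p c ⊓ p cᶜ) := map_inf p c cᶜ
    rw [inf_compl_eq_bot, map_bot] at h2
    exact h2.mpr ⟨h, h'⟩
  have le_s : ∀ c, ¬ p c → c ≤ s := fun c hc => le_sSup hc
  refine ⟨sᶜ, ⟨fun h => ?_, fun c hc => ?_⟩, compl_le_of_compl_le (le_s _ (not_both b hb))⟩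
  · have := (mem_or s).resolve_left hps
    rw [h, map_bot] at this
    exact this
  · have hpc : ¬ p c := fun h =>
      hc.not_ge (compl_le_of_compl_le (le_s _ (not_both c h)))
    exact disjoint_self.1 ((disjoint_compl_right (a := s)).mono (le_s c hpc) hc.le)

namespace NecessityOperator

variable {B : Type u} [CompleteBooleanAlgebra B]

theorem isAtomic_of_isSpatialFrame (h : IsSpatialFrame (NecessityOperator B)) : IsAtomic B := by
  obtain ⟨-, X, _, ⟨φ⟩⟩ := h
  refine ⟨fun b => or_iff_not_imp_left.2 fun hb => ?_⟩
  have : Nontrivial B := ⟨b, ⊥, hb⟩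
  have hne : φ (const b) ≠ ⊥ := fun h => hb <| by
    have h0 : const b = ⊥ := (map_eq_bot_iff φ).1 h
    rw [← const_apply (b := b) (bot_ne_top (α := B)), h0, bot_eq_const, const_apply bot_ne_top]
  obtain ⟨x, hx⟩ : ∃ x, x ∈ φ (const b) := by
    by_contra! hn
    exact hne (TopologicalSpace.Opens.ext (Set.eq_empty_of_forall_notMem hn))
  let p : FrameHom B Prop :=
    { toFun := fun c => x ∈ φ (const c)
      map_inf' := fun c d => by rw [const_inf, map_inf]; rfl
      map_top' := by rw [const_top, map_top]; rfl
      map_sSup' := fun S => by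
        simp only [const_sSup, map_iSup, TopologicalSpace.Opens.mem_iSup, sSup_image,
          iSup_Prop_eq] }
  exact exists_isAtom_le_of_frameHom p hx

end NecessityOperator

theorem mainTheorem3 (B : Type u) [CompleteBooleanAlgebra B] :
    IsZeroDimensionalFrame (NecessityOperator B) ∧
      (IsSpatialFrame (NecessityOperator B) ↔ IsAtomic B) :=
  ⟨⟨inferInstance, rfl, NecessityOperator.isZeroDimensional⟩,
    NecessityOperator.isAtomic_of_isSpatialFrame, fun _ => NecessityOperator.isSpatialFrame⟩
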